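/- Let $\Gamma$ be a finite digraph with vertex set $V(\Gamma)=\{1,\dots,n\}$ and arc set $E(\Gamma)$ in which every arc carries a positive weight. The weight of a subgraph is the product of the weights of its arcs, and the weight $\varepsilon(S)$ of a set $S$ of subgraphs is the sum of the weights of its elements. A diverging tree is a rooted directed tree in which directed paths lead from the root to all other vertices; a diverging forest is a directed forest all of whose weak components are diverging trees. An out-forest of $\Gamma$ is a spanning diverging forest of $\Gamma$; it is a maximum out-forest if no out-forest of $\Gamma$ has more arcs. Let $d$ be the number of trees in any maximum out-forest of $\Gamma$ (so that a maximum out-forest has $n-d$ arcs), and let $\sigma_{n-d}$ be the weight of the set of all maximum out-forests of $\Gamma$. The normalized matrix of maximum out-forests is the matrix $\bar J=(\bar J_{ij})_{n\times n}$, where $\bar J_{ij}$ is the total weight of those maximum out-forests of $\Gamma$ in which $i$ belongs to a tree diverging from $j$, divided by $\sigma_{n-d}$. A bicomponent of $\Gamma$ is a maximal strongly connected subgraph; it is a basis bicomponent if no arc of $\Gamma$ enters it from outside. Every vertex is reachable from itself. A vertex that forms a basis bicomponent by itself is called undominated. Let $\widetilde K$ be the union of the vertex sets of all basis bicomponents.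 For the vertex set $K$ of a basis bicomponent, let $K^+$ be the set of vertices reachable from $K$ and unreachable from the other basis bicomponents; let $\mathsf T$ be the set of spanning diverging trees of the restriction $\Gamma_K$ of $\Gamma$ to $K$, and $\mathsf T^j$ the set of those that diverge from $j\in K$; let $\Gamma_{-K}$ be the spanning subgraph of $\Gamma$ with arc set $E(\Gamma)\setminus E(\Gamma_K)$; and for $i\in V(\Gamma)$ let $\mathsf P^{K\to i}$ be the set of maximum out-forests of $\Gamma_{-K}$ in which $i$ is reachable from some vertex of $K$. Then: 1. $\bar J$ is row stochastic: $\bar J_{ij}\ge 0$ and $\sum_{k=1}^n \bar J_{ik}=1$ for all $i,j\in V(\Gamma)$. 2. For all $i,j\in V(\Gamma)$: $\bar J_{ij}\ne 0$ if and only if $j\in\widetilde K$ and $i$ is reachable from $j$ in $\Gamma$. 3. Let $K$ be the vertex set of a basis bicomponent and $j\in K$. For every $i\in V(\Gamma)$, $\bar J_{ij}=\varepsilon(\mathsf T^j)\,\varepsilon(\mathsf P^{K\to i})/\sigma_{n-d}$. Moreover, if $i\in K^+$, then $\bar J_{ij}=\bar J_{jj}=\varepsilon(\mathsf T^j)/\varepsilon(\mathsf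 T)$. 4. For the vertex set $K$ of every basis bicomponent, $\sum_{j\in K}\bar J_{jj}=1$. In particular, if $j$ is an undominated vertex, then $\bar J_{jj}=1$. 5. If $K$ is the vertex set of a basis bicomponent and $j_1,j_2\in K$, then $\bar J_{\cdot j_2}=\bigl(\varepsilon(\mathsf T^{j_2})/\varepsilon(\mathsf T^{j_1})\bigr)\bar J_{\cdot j_1}$, where $\bar J_{\cdot j}$ denotes the $j$-th column of $\bar J$. -/

import Mathlib

namespace Digraph

variable {V : Type*}

instance finite_of_finite [Finite V] : Finite (Digraph V) :=
  Finite.of_injective _ Digraph.adj_injective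

/-- `v` is reachable from `u` by a directed path (possibly of length zero). -/
def Reaches (G : Digraph V) (u v : V) : Prop := Relation.ReflTransGen G.Adj u v

/-- The subgraph induced on a set `S` of vertices; its vertex set is `S` itself. -/
def inducedOn (G : Digraph V) (S : Set V) : Digraph S where
  Adj u v := G.Adj u v

/-- Strong connectedness: there is a directed path from every vertex to every vertex. -/
def IsStrong (G : Digraph V) : Prop := ∀ u v, G.Reaches u v

/-- `K` is the vertex set of a bicomponent (strong component): `K` is maximal by inclusion among
the nonempty vertex sets which induce a strong digraph. -/
def IsBicomponent (G : Digraph V) (K : Set V) : Prop :=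
  Maximal (fun S : Set V => S.Nonempty ∧ (G.inducedOn S).IsStrong) K

/-- `K` is the vertex set of a basis bicomponent: a bicomponent that no arc enters from outside. -/
def IsBasisBicomponent (G : Digraph V) (K : Set V) : Prop :=
  G.IsBicomponent K ∧ ∀ u ∉ K, ∀ v ∈ K, ¬ G.Adj u v

/-- The union of the vertex sets of all basis bicomponents. -/
def basisVertices (G : Digraph V) : Set V := {j | ∃ K, G.IsBasisBicomponent K ∧ j ∈ K}

/-- A vertex that forms a basis bicomponent by itself. -/
def IsUndominated (G : Digraph V) (j : V) : Prop := G.IsBasisBicomponent {j}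

/-- The vertices reachable from `K` and unreachable from all basis bicomponents other
than `K`. -/
def exclusiveReach (G : Digraph V) (K : Set V) : Set V :=
  {i | (∃ k ∈ K, G.Reaches k i) ∧
    ∀ K', G.IsBasisBicomponent K' → K' ≠ K → ∀ k ∈ K', ¬ G.Reaches k i}

/-- The vertex set of the weak component of `v`: the vertices joined to `v` by a path in which the
directions of the arcs are ignored. -/
def weakComponent (G : Digraph V) (v : V) : Set V := {w | Relation.EqvGen G.Adj v w}

/-- `T` is a tree (on the whole of `V`) diverging from the root `r`: directed paths lead from `r`
to all vertices, no arc enters `r`, and exactly one arc enters every other vertex. -/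
structure IsDivergingTree (T : Digraph V) (r : V) : Prop where
  reaches : ∀ v, T.Reaches r v
  root : ∀ u, ¬ T.Adj u r
  existsUnique_arc : ∀ v, v ≠ r → ∃! u, T.Adj u v

/-- In `F`, vertex `i` belongs to a tree diverging from `j`, that is, the weak component of `i`
is a diverging tree with root `j`. -/
def InTreeFrom (F : Digraph V) (i j : V) : Prop :=
  ∃ h : j ∈ F.weakComponent i, (F.inducedOn (F.weakComponent i)).IsDivergingTree ⟨j, h⟩

/-- A diverging forest: all weak components are diverging trees. -/
def IsDivergingForest (F : Digraph V) : Prop := ∀ i, ∃ j, F.InTreeFrom i j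

/-- The finite set of arcs; the pair `(u, v)` is the arc from `u` to `v`. -/
noncomputable def arcs [Finite V] (G : Digraph V) : Finset (V × V) :=
  (Set.toFinite {p : V × V | G.Adj p.1 p.2}).toFinset

/-- Out-forests of `G`: its spanning diverging forests. -/
def outForests (G : Digraph V) : Set (Digraph V) := {F | F ≤ G ∧ F.IsDivergingForest}

/-- Maximum out-forests of `G`: no out-forest of `G` has more arcs. -/
def maxOutForests [Finite V] (G : Digraph V) : Set (Digraph V) :=
  {F | F ∈ G.outForests ∧ ∀ F' ∈ G.outForests, F'.arcs.card ≤ F.arcs.card}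

/-- Spanning diverging trees of `G` that diverge from `r`. -/
def spanningTreesFrom (G : Digraph V) (r : V) : Set (Digraph V) :=
  {T | T ≤ G ∧ T.IsDivergingTree r}

/-- Spanning diverging trees of `G`. -/
def spanningTrees (G : Digraph V) : Set (Digraph V) := {T | ∃ r, T ∈ G.spanningTreesFrom r}

end Digraph

/-- A digraph whose arcs carry positive weights; `weight u v` is the weight of the arc from `u`
to `v`, and its value is never used when there is no such arc. -/
structure WeightedDigraph (V : Type*) extends Digraph V where
  weight : V → V → ℝ
  weight_pos : ∀ u v, toDigraph.Adj u v → 0 < weight u v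

namespace WeightedDigraph

variable {V : Type*}

/-- The restriction of `Γ` to the vertex set `K`. -/
def restrict (Γ : WeightedDigraph V) (K : Set V) : WeightedDigraph K where
  toDigraph := Γ.toDigraph.inducedOn K
  weight u v := Γ.weight u v
  weight_pos u v h := Γ.weight_pos u v h

/-- The spanning subgraph of `Γ` obtained by removing the arcs of the restriction of `Γ`
to `K`. -/
def deleteWithin (Γ : WeightedDigraph V) (K : Set V) : WeightedDigraph V where
  Adj u v := Γ.Adj u v ∧ ¬ (u ∈ K ∧ v ∈ K)
  weight := Γ.weight
  weight_pos u v h := Γ.weight_pos u v h.1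

/-- The weight of a set `S` of spanning subgraphs of `Γ`: the sum of the weights of its elements,
where the weight of a subgraph is the product of the weights of its arcs. -/
noncomputable def weightOf [Finite V] (Γ : WeightedDigraph V) (S : Set (Digraph V)) : ℝ :=
  ∑ H ∈ (Set.toFinite S).toFinset, ∏ p ∈ H.arcs, Γ.weight p.1 p.2

/-- The weight of the set of maximum out-forests of `Γ`. -/
noncomputable def sigmaMax [Finite V] (Γ : WeightedDigraph V) : ℝ :=
  Γ.weightOf Γ.toDigraph.maxOutForests

/-- The normalized matrix of maximum out-forests: the `(i, j)` entry is the share, by weight, of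
the maximum out-forests in which `i` belongs to a tree diverging from `j`. -/
noncomputable def normalizedForestMatrix [Finite V] (Γ : WeightedDigraph V) : Matrix V V ℝ :=
  Matrix.of fun i j =>
    Γ.weightOf {F | F ∈ Γ.toDigraph.maxOutForests ∧ F.InTreeFrom i j} / Γ.sigmaMax

/-- The weight of the set of spanning diverging trees in the restriction of `Γ` to `K`. -/
noncomputable def treeWeight [Finite V] (Γ : WeightedDigraph V) (K : Set V) : ℝ :=
  (Γ.restrict K).weightOf (Γ.restrict K).toDigraph.spanningTrees

/-- The weight of the set of spanning diverging trees in the restriction of `Γ` to `K` that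
diverge from `j`. -/
noncomputable def treeWeightFrom [Finite V] (Γ : WeightedDigraph V) (K : Set V) (j : K) : ℝ :=
  (Γ.restrict K).weightOf ((Γ.restrict K).toDigraph.spanningTreesFrom j)

/-- The weight of the set of those maximum out-forests of `Γ.deleteWithin K` in which `i` is
reachable from some vertex of `K`. -/
noncomputable def forestWeightTo [Finite V] (Γ : WeightedDigraph V) (K : Set V) (i : V) : ℝ :=
  (Γ.deleteWithin K).weightOf
    {F | F ∈ (Γ.deleteWithin K).toDigraph.maxOutForests ∧ ∃ k ∈ K, F.Reaches k i}

end WeightedDigraph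

/-! An out-forest has n minus (number of roots) arcs, so maximum means fewest roots. This happens
exactly when no root is reachable in Γ from another one (`mem_maxOutForests_iff`). Hence roots lie
in basis bicomponents, exactly one in each.

No arc enters a basis bicomponent K. A maximum out-forest with root j in K therefore splits into a
spanning tree of Γ_K diverging from j and a maximum out-forest of Γ_{-K}. Any two such pieces can be
glued back, and weights multiply. Vertex i lies below j exactly when the second piece reaches i from
K, which gives the product formula (`weightOf_inTreeFrom`). Its second factor does not involve j, so
columns over K are proportional. For i in K^+ the reachability condition is automatic, so the entry
does not depend on i.

Rows sum to 1 because each vertex has one root. For i in K the row is supported on K and its entries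
are the diagonal ones; this gives the diagonal sum and fixes the normalization ε(T^j)/ε(T). The
support of the matrix comes from re-rooting a maximum out-forest (`exists_maxOutForest_reaches`). -/

namespace Digraph

variable {V : Type*} {G H F : Digraph V} {K S : Set V} {i j u v : V}

/-! ### Reachability, initial sets and forests -/

theorem Reaches.trans {w : V} (h₁ : G.Reaches u v) (h₂ : G.Reaches v w) : G.Reaches u w :=
  Relation.ReflTransGen.trans h₁ h₂

theorem Reaches.mono (h : F ≤ G) (hr : F.Reaches u v) : G.Reaches u v :=
  Relation.ReflTransGen.mono (fun _ _ ha => h ha) _ _ hr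

/-- A set of vertices that no arc enters from outside. -/
def IsInitial (G : Digraph V) (S : Set V) : Prop := ∀ u v, G.Adj u v → v ∈ S → u ∈ S

theorem IsInitial.mem_of_reaches (hS : G.IsInitial S) (h : G.Reaches u v) (hv : v ∈ S) :
    u ∈ S := by
  induction h using Relation.ReflTransGen.head_induction_on with
  | refl => exact hv
  | head h _ ih => exact hS _ _ h ih

theorem IsInitial.mono (hS : G.IsInitial S) (h : F ≤ G) : F.IsInitial S :=
  fun u v ha hv => hS u v (h ha) hv

theorem Reaches.of_inducedOn {a b : S} (h : (G.inducedOn S).Reaches a b) : G.Reaches a b :=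
  Relation.ReflTransGen.lift (p := G.Adj) Subtype.val (fun _ _ ha => ha) _ _ h

theorem IsInitial.reaches_inducedOn (hS : G.IsInitial S) (h : G.Reaches u v) (hu : u ∈ S)
    (hv : v ∈ S) : (G.inducedOn S).Reaches ⟨u, hu⟩ ⟨v, hv⟩ := by
  induction h using Relation.ReflTransGen.head_induction_on with
  | refl => exact Relation.ReflTransGen.refl
  | @head a c h hr ih =>
    have hc := hS.mem_of_reaches hr hv
    have hac : (G.inducedOn S).Adj ⟨a, hu⟩ ⟨c, hc⟩ := h
    exact Relation.ReflTransGen.head hac (ih hc)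

/-- No arc enters `r`. -/
def IsRoot (F : Digraph V) (r : V) : Prop := ∀ u, ¬ F.Adj u r

theorem IsRoot.eq_of_reaches {r : V} (hr : F.IsRoot r) (h : F.Reaches u r) : u = r := by
  rcases Relation.ReflTransGen.cases_tail h with h | ⟨w, _, h⟩
  · exact h.symm
  · exact absurd h (hr w)

/-- At most one arc enters each vertex, and each vertex is reachable from one that no arc
enters. -/
structure IsForest (F : Digraph V) : Prop where
  unique : ∀ u u' v, F.Adj u v → F.Adj u' v → u = u'
  exists_root : ∀ v, ∃ r, F.IsRoot r ∧ F.Reaches r v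

theorem IsForest.reaches_of_adj (hF : F.IsForest) (hj : F.IsRoot j) (h : F.Adj u v)
    (hr : F.Reaches j v) : F.Reaches j u := by
  rcases Relation.ReflTransGen.cases_tail hr with rfl | ⟨w, hw, h'⟩
  · exact absurd h (hj u)
  · exact hF.unique _ _ _ h h' ▸ hw

/-- A path from the root j to the head of an arc must use that arc, the only one entering its head.
So reachability from j passes both ways along arcs. -/
theorem IsForest.reaches_of_eqvGen (hF : F.IsForest) (hj : F.IsRoot j)
    (h : Relation.EqvGen F.Adj u v) : F.Reaches j u ↔ F.Reaches j v := by
  induction h with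
  | rel x y h => exact ⟨fun hx => hx.tail h, hF.reaches_of_adj hj h⟩
  | refl => exact Iff.rfl
  | symm _ _ _ ih => exact ih.symm
  | trans _ _ _ _ _ ih₁ ih₂ => exact ih₁.trans ih₂

theorem Reaches.eqvGen (h : F.Reaches u v) : Relation.EqvGen F.Adj u v := by
  induction h with
  | refl => exact .refl _
  | tail _ h ih => exact ih.trans _ _ _ (.rel _ _ h)

theorem isInitial_weakComponent : F.IsInitial (F.weakComponent i) := fun u v h hv =>
  Relation.EqvGen.trans _ _ _ hv (.symm _ _ (.rel u v h))

theorem IsForest.root_unique (hF : F.IsForest) {r r' : V} (hr : F.IsRoot r) (hr' : F.IsRoot r')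
    (h : F.Reaches r v) (h' : F.Reaches r' v) : r = r' :=
  hr'.eq_of_reaches ((hF.reaches_of_eqvGen hr h'.eqvGen).2 h)

theorem InTreeFrom.isRoot (h : F.InTreeFrom i j) : F.IsRoot j := by
  obtain ⟨hj, ht⟩ := h
  exact fun u hu => ht.root ⟨u, isInitial_weakComponent u j hu hj⟩ hu

theorem InTreeFrom.reaches (h : F.InTreeFrom i j) : F.Reaches j i := by
  obtain ⟨hj, ht⟩ := h
  exact (ht.reaches ⟨i, .refl _⟩).of_inducedOn

theorem IsForest.inTreeFrom (hF : F.IsForest) (hj : F.IsRoot j) (h : F.Reaches j i) :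
    F.InTreeFrom i j := by
  have hmem : j ∈ F.weakComponent i := Relation.EqvGen.symm _ _ h.eqvGen
  have hreach : ∀ v ∈ F.weakComponent i, F.Reaches j v := fun v hv =>
    (hF.reaches_of_eqvGen hj hv).1 h
  refine ⟨hmem, fun v => ?_, fun u hu => hj u hu, fun v hv => ?_⟩
  · exact isInitial_weakComponent.reaches_inducedOn (hreach v v.2) _ _
  · rcases Relation.ReflTransGen.cases_tail (hreach v v.2) with h | ⟨w, _, hw⟩
    · exact absurd (Subtype.ext h) hv
    · exact ⟨⟨w, isInitial_weakComponent w v hw v.2⟩, hw,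
        fun y hy => Subtype.ext (hF.unique _ _ _ hy hw)⟩

/-- Trades the definition by weak components for local conditions that survive cutting and gluing.
-/
theorem isDivergingForest_iff : F.IsDivergingForest ↔ F.IsForest := by
  refine ⟨fun h => ⟨fun u u' v hu hu' => ?_, fun v => ?_⟩, fun h i => ?_⟩
  · obtain ⟨j, hj, ht⟩ := h v
    have hv : v ∈ F.weakComponent v := .refl _
    have hne : (⟨v, hv⟩ : F.weakComponent v) ≠ ⟨j, hj⟩ := by
      rintro he
      obtain rfl : v = j := congrArg Subtype.val he
      exact ht.root ⟨u, isInitial_weakComponent u v hu hv⟩ hu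
    exact congrArg Subtype.val ((ht.existsUnique_arc _ hne).unique
      (y₁ := ⟨u, isInitial_weakComponent u v hu hv⟩)
      (y₂ := ⟨u', isInitial_weakComponent u' v hu' hv⟩) hu hu')
  · obtain ⟨j, hj⟩ := h v
    exact ⟨j, hj.isRoot, hj.reaches⟩
  · obtain ⟨r, hr, hri⟩ := h.exists_root i
    exact ⟨r, h.inTreeFrom hr hri⟩

theorem IsForest.existsUnique_inTreeFrom (hF : F.IsForest) (i : V) : ∃! j, F.InTreeFrom i j := by
  obtain ⟨r, hr, hri⟩ := hF.exists_root i
  exact ⟨r, hF.inTreeFrom hr hri, fun y hy => hF.root_unique hy.isRoot hr hy.reaches hri⟩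

/-- The set of vertices reachable from `R` by at most `n` arcs. -/
def layer (G : Digraph V) (R : Set V) : ℕ → Set V
  | 0 => R
  | n + 1 => G.layer R n ∪ {v | ∃ u ∈ G.layer R n, G.Adj u v}

theorem exists_mem_layer {R : Set V} {r : V} (hr : r ∈ R) (h : G.Reaches r v) :
    ∃ n, v ∈ G.layer R n := by
  induction h with
  | refl => exact ⟨0, hr⟩
  | tail _ h ih =>
    obtain ⟨n, hn⟩ := ih
    exact ⟨n + 1, Or.inr ⟨_, hn, h⟩⟩

/-- A breadth-first search from `R` yields a forest with root set `R`. -/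
theorem exists_isForest (R : Set V) (hR : ∀ v, ∃ r ∈ R, G.Reaches r v) :
    ∃ F ≤ G, F.IsForest ∧ ∀ r, F.IsRoot r ↔ r ∈ R := by
  classical
  have hex : ∀ v, ∃ n, v ∈ G.layer R n := fun v =>
    let ⟨_, hr, h⟩ := hR v
    exists_mem_layer hr h
  -- The parent lies in a strictly earlier layer, so following parents ends in R. For v in R the
  -- value is a dummy.
  have hpar : ∀ v, ∃ u, v ∉ R → G.Adj u v ∧ Nat.find (hex u) < Nat.find (hex v) := by
    intro v
    by_cases hv : v ∈ R
    · exact ⟨v, fun h => absurd hv h⟩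
    have hspec := Nat.find_spec (hex v)
    rcases hn : Nat.find (hex v) with _ | n
    · rw [hn] at hspec
      exact absurd hspec hv
    · rw [hn] at hspec
      have hnot : v ∉ G.layer R n := Nat.find_min (hex v) (by omega)
      obtain ⟨u, hu, huv⟩ := hspec.resolve_left hnot
      exact ⟨u, fun _ => ⟨huv, Nat.lt_succ_of_le (Nat.find_min' (hex u) hu)⟩⟩
  choose p hp using hpar
  have hroot : ∀ r, (⟨fun u v => v ∉ R ∧ u = p v⟩ : Digraph V).IsRoot r ↔ r ∈ R := by
    intro r
    refine ⟨fun h => ?_, fun h u hu => hu.1 h⟩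
    by_contra hr
    exact h (p r) ⟨hr, rfl⟩
  refine ⟨⟨fun u v => v ∉ R ∧ u = p v⟩, ?_, ⟨?_, ?_⟩, hroot⟩
  · rintro u v ⟨hv, rfl⟩
    exact (hp v hv).1
  · rintro u u' v ⟨_, rfl⟩ ⟨_, rfl⟩
    rfl
  · intro v
    induction h : Nat.find (hex v) using Nat.strong_induction_on generalizing v with
    | _ n ih =>
      by_cases hv : v ∈ R
      · exact ⟨v, (hroot v).2 hv, .refl⟩
      · obtain ⟨r, hr, hrv⟩ := ih _ (h ▸ (hp v hv).2) (p v) rfl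
        exact ⟨r, hr, hrv.tail ⟨hv, rfl⟩⟩

/-! ### Maximum out-forests and their roots -/

section Finite

variable [Finite V]

theorem mem_arcs {p : V × V} : p ∈ F.arcs ↔ F.Adj p.1 p.2 := by simp [arcs]

/-- Sending an arc to its head is a bijection onto the non-roots. -/
theorem IsForest.card_arcs_add (hF : F.IsForest) :
    F.arcs.card + {r | F.IsRoot r}.ncard = Nat.card V := by
  classical
  have h : F.arcs.card = {r | F.IsRoot r}ᶜ.ncard := by
    have hinj : Set.InjOn Prod.snd (F.arcs : Set (V × V)) := by
      rintro ⟨a, b⟩ hab ⟨c, d⟩ hcd (rfl : b = d)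
      rw [hF.unique a c b (mem_arcs.1 hab) (mem_arcs.1 hcd)]
    rw [← Finset.card_image_of_injOn hinj, ← Set.ncard_coe_finset]
    congr 1
    ext v
    simp [mem_arcs, IsRoot]
  rw [h, add_comm, Set.ncard_add_ncard_compl]

/-- Maximum out-forests are the forests whose roots are pairwise unreachable. -/
theorem mem_maxOutForests_iff : F ∈ G.maxOutForests ↔
    F ≤ G ∧ F.IsForest ∧ ∀ r r', F.IsRoot r → F.IsRoot r' → G.Reaches r r' → r = r' := by
  simp only [maxOutForests, outForests, Set.mem_ofPred_eq, isDivergingForest_iff, and_assoc]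
  refine and_congr_right fun hFG => and_congr_right fun hF => ⟨fun hmax r r' hr hr' h => ?_, ?_⟩
  · by_contra hne
    -- The root r can take over everything below r', so r' can be dropped, which leaves fewer roots
    -- and more arcs.
    obtain ⟨F', hF'G, hF', hroot⟩ := exists_isForest (G := G) ({r | F.IsRoot r} \ {r'}) (by
      intro v
      obtain ⟨s, hs, hsv⟩ := hF.exists_root v
      by_cases hsr : s = r'
      · exact ⟨r, ⟨hr, hne⟩, h.trans (hsr ▸ hsv.mono hFG)⟩
      · exact ⟨s, ⟨hs, hsr⟩, hsv.mono hFG⟩)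
    have h₁ := hF.card_arcs_add
    have h₂ := hF'.card_arcs_add
    have h₃ := hmax F' ⟨hF'G, hF'⟩
    have h₄ : {r | F'.IsRoot r} = {r | F.IsRoot r} \ {r'} := by
      ext s
      exact hroot s
    have h₅ := Set.ncard_sdiff_singleton_lt_of_mem (s := {r | F.IsRoot r}) hr'
    rw [h₄] at h₂
    omega
  · rintro hroots F' ⟨hF'G, hF'⟩
    choose f hf hfr using hF'.exists_root
    -- The root of F above f r reaches r through f r, so it is r itself. Thus r and f r reach each
    -- other, and f is injective on the roots of F.
    have hback : ∀ r, F.IsRoot r → G.Reaches r (f r) := by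
      intro r hr
      obtain ⟨s, hs, hsf⟩ := hF.exists_root (f r)
      obtain rfl := hroots s r hs hr ((hsf.mono hFG).trans ((hfr r).mono hF'G))
      exact hsf.mono hFG
    have hle : {r | F.IsRoot r}.ncard ≤ {r | F'.IsRoot r}.ncard := by
      refine Set.ncard_le_ncard_of_injOn f (fun r _ => hf r) (fun r hr s hs hrs => ?_)
      exact hroots r s hr hs ((hback r hr).trans (hrs ▸ (hfr s).mono hF'G))
    have h₁ := hF.card_arcs_add
    have h₂ := hF'.card_arcs_add
    omega

theorem isForest_of_mem_maxOutForests (hF : F ∈ G.maxOutForests) : F.IsForest :=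
  (mem_maxOutForests_iff.1 hF).2.1

theorem maxOutForests_nonempty (G : Digraph V) : G.maxOutForests.Nonempty := by
  obtain ⟨F₀, h₀, hF₀, -⟩ := exists_isForest (G := G) Set.univ fun v => ⟨v, trivial, .refl⟩
  obtain ⟨F, hF, hmax⟩ := Set.exists_max_image G.outForests (fun F => F.arcs.card)
    (Set.toFinite _) ⟨F₀, h₀, isDivergingForest_iff.2 hF₀⟩
  exact ⟨F, hF, hmax⟩

/-- Every vertex from which `j` is reachable is reachable from `j`. -/
def IsSource (G : Digraph V) (j : V) : Prop := ∀ u, G.Reaches u j → G.Reaches j u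

theorem isSource_of_isRoot (hF : F ∈ G.maxOutForests) (hj : F.IsRoot j) : G.IsSource j := by
  obtain ⟨hFG, hF, hroots⟩ := mem_maxOutForests_iff.1 hF
  intro u hu
  obtain ⟨r, hr, hru⟩ := hF.exists_root u
  obtain rfl := hroots r j hr hj ((hru.mono hFG).trans hu)
  exact hru.mono hFG

/-- Starting from any maximum out-forest, move a root to j and force everything reachable from j to
hang from j. -/
theorem exists_maxOutForest_reaches (hj : G.IsSource j) (h : G.Reaches j i) :
    ∃ F ∈ G.maxOutForests, F.InTreeFrom i j := by
  obtain ⟨F₀, hF₀⟩ := G.maxOutForests_nonempty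
  have hsource : ∀ r, F₀.IsRoot r → G.IsSource r := fun r => isSource_of_isRoot hF₀
  obtain ⟨hle₀, hfor₀, hroots₀⟩ := mem_maxOutForests_iff.1 hF₀
  -- As j is a source, a root that reaches j is also reachable from j; j replaces it.
  let R : Set V := {r | r = j ∨ F₀.IsRoot r ∧ ¬ G.Reaches r j}
  -- Arcs entering the set reachable from j are dropped. The set becomes initial, so the root above
  -- i must lie in it, and j is the only element of R there.
  let H : Digraph V := ⟨fun u v => G.Adj u v ∧ (G.Reaches j v → G.Reaches j u)⟩
  have hHG : H ≤ G := fun u v h => h.1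
  have hHj : ∀ v, G.Reaches j v → H.Reaches j v := by
    intro v hv
    induction hv with
    | refl => exact .refl
    | tail h₁ h₂ ih => exact ih.tail ⟨h₂, fun _ => h₁⟩
  have hH : ∀ r v, G.Reaches r v → H.Reaches r v ∨ H.Reaches j v := by
    intro r v hv
    induction hv with
    | refl => exact Or.inl .refl
    | @tail b c h₁ h₂ ih =>
      by_cases hc : G.Reaches j c
      · exact Or.inr (hHj _ hc)
      · exact ih.imp (fun h => h.tail ⟨h₂, fun h => absurd h hc⟩)
          (fun h => h.tail ⟨h₂, fun h => absurd h hc⟩)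
  have hRun : ∀ r r', r ∈ R → r' ∈ R → G.Reaches r r' → r = r' := by
    rintro r r' (rfl | ⟨hr, hrj⟩) (rfl | ⟨hr', hrj'⟩) hrr
    · rfl
    · exact absurd (hsource r' hr' _ hrr) hrj'
    · exact absurd hrr hrj
    · exact hroots₀ _ _ hr hr' hrr
  obtain ⟨F, hFH, hF, hroot⟩ := exists_isForest (G := H) R (by
    intro v
    obtain ⟨r, hr, hrv⟩ := hfor₀.exists_root v
    by_cases hrj : G.Reaches r j
    · exact ⟨j, Or.inl rfl, hHj v ((hj r hrj).trans (hrv.mono hle₀))⟩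
    · rcases hH r v (hrv.mono hle₀) with h | h
      · exact ⟨r, Or.inr ⟨hr, hrj⟩, h⟩
      · exact ⟨j, Or.inl rfl, h⟩)
  have hFG : F ≤ G := fun u v h => hHG (hFH h)
  refine ⟨F, mem_maxOutForests_iff.2 ⟨hFG, hF, fun r r' hr hr' =>
    hRun r r' ((hroot r).1 hr) ((hroot r').1 hr')⟩, ?_⟩
  have hjroot : F.IsRoot j := (hroot j).2 (Or.inl rfl)
  obtain ⟨r, hr, hri⟩ := hF.exists_root i
  have hinit : H.IsInitial {v | G.Reaches j v} := fun u v h hv => h.2 hv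
  have hjr : G.Reaches j r := hinit.mem_of_reaches (hri.mono hFH) h
  obtain rfl := hRun j r (Or.inl rfl) ((hroot r).1 hr) hjr
  exact hF.inTreeFrom hr hri

end Finite

/-! ### Basis bicomponents -/

theorem IsBasisBicomponent.isInitial (hK : G.IsBasisBicomponent K) : G.IsInitial K := by
  intro u v h hv
  by_contra hu
  exact hK.2 u hu v hv h

theorem IsBasisBicomponent.reaches (hK : G.IsBasisBicomponent K) (hu : u ∈ K) (hv : v ∈ K) :
    G.Reaches u v :=
  (hK.1.prop.2 ⟨u, hu⟩ ⟨v, hv⟩).of_inducedOn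

theorem IsBasisBicomponent.eq_of_mem {K' : Set V} (hK : G.IsBasisBicomponent K)
    (hK' : G.IsBasisBicomponent K') (hu : u ∈ K) (hu' : u ∈ K') : K = K' := by
  ext v
  exact ⟨fun hv => hK'.isInitial.mem_of_reaches (hK.reaches hv hu) hu',
    fun hv => hK.isInitial.mem_of_reaches (hK'.reaches hv hu') hu⟩

theorem IsBasisBicomponent.isSource (hK : G.IsBasisBicomponent K) (hj : j ∈ K) : G.IsSource j :=
  fun _ hu => hK.reaches hj (hK.isInitial.mem_of_reaches hu hj)

theorem mem_basisVertices_iff : j ∈ G.basisVertices ↔ G.IsSource j := by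
  refine ⟨fun ⟨K, hK, hj⟩ => hK.isSource hj, fun h => ?_⟩
  have hinit : G.IsInitial {u | G.Reaches u j} := fun u v ha hv => Relation.ReflTransGen.head ha hv
  -- For a source j, the vertices that reach j are also reachable from j, and no arc enters their
  -- set.
  refine ⟨{u | G.Reaches u j}, ⟨⟨⟨⟨j, .refl⟩, ?_⟩, ?_⟩, ?_⟩, .refl⟩
  · rintro ⟨u, hu⟩ ⟨v, hv⟩
    exact hinit.reaches_inducedOn (Reaches.trans hu (h v hv)) hu hv
  · rintro S ⟨-, hS⟩ hle s hs
    exact (hS ⟨s, hs⟩ ⟨j, hle .refl⟩).of_inducedOn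
  · exact fun u hu v hv ha => hu (hinit u v ha hv)

theorem IsBasisBicomponent.subset_exclusiveReach (hK : G.IsBasisBicomponent K) :
    K ⊆ G.exclusiveReach K := fun i hi =>
  ⟨⟨i, hi, .refl⟩, fun _ hK' hne _ hk h =>
    hne (hK'.eq_of_mem hK hk (hK.isInitial.mem_of_reaches h hi))⟩

/-- Removal of the arcs with both ends in `K`. -/
def removeWithin (G : Digraph V) (K : Set V) : Digraph V where
  Adj u v := G.Adj u v ∧ ¬ (u ∈ K ∧ v ∈ K)

/-- A digraph on `K` together with a digraph on the whole vertex set. -/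
def joinOn (T : Digraph K) (F : Digraph V) : Digraph V where
  Adj u v := (∃ (hu : u ∈ K) (hv : v ∈ K), T.Adj ⟨u, hu⟩ ⟨v, hv⟩) ∨ F.Adj u v

theorem removeWithin_le : G.removeWithin K ≤ G := fun _ _ h => h.1

theorem removeWithin_mono (h : F ≤ G) : F.removeWithin K ≤ G.removeWithin K :=
  fun _ _ ha => ⟨h ha.1, ha.2⟩

theorem IsInitial.isRoot_removeWithin (hK : G.IsInitial K) (hv : v ∈ K) :
    (G.removeWithin K).IsRoot v := fun u h => h.2 ⟨hK u v h.1 hv, hv⟩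

theorem IsRoot.mono (h : F ≤ G) (hv : G.IsRoot v) : F.IsRoot v := fun u ha => hv u (h ha)

theorem isRoot_of_isRoot_removeWithin (hv : v ∉ K) (h : (G.removeWithin K).IsRoot v) :
    G.IsRoot v := fun u ha => h u ⟨ha, fun hh => hv hh.2⟩

/-- Cut the path after its last arc inside K. -/
theorem reaches_removeWithin (h : G.Reaches u v) :
    (G.removeWithin K).Reaches u v ∨ ∃ k ∈ K, (G.removeWithin K).Reaches k v := by
  induction h with
  | refl => exact Or.inl .refl
  | @tail b c _ h ih =>
    by_cases hbc : b ∈ K ∧ c ∈ K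
    · exact Or.inr ⟨c, hbc.2, .refl⟩
    · exact ih.imp (fun h' => h'.tail ⟨h, hbc⟩)
        fun ⟨k, hk, h'⟩ => ⟨k, hk, h'.tail ⟨h, hbc⟩⟩

/-! ### Splitting and gluing along a basis bicomponent -/

section Finite

variable [Finite V]

/-- The root above a vertex of K lies in K, since no arc enters K; being reachable from j, it equals
j. -/
theorem isDivergingTree_inducedOn (hK : G.IsBasisBicomponent K) (hF : F ∈ G.maxOutForests)
    (hj : F.IsRoot j) (hjK : j ∈ K) : (F.inducedOn K).IsDivergingTree ⟨j, hjK⟩ := by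
  obtain ⟨hFG, hF, hroots⟩ := mem_maxOutForests_iff.1 hF
  have hinit := hK.isInitial.mono hFG
  have hreach : ∀ v ∈ K, F.Reaches j v := by
    intro v hv
    obtain ⟨r, hr, hrv⟩ := hF.exists_root v
    obtain rfl := hroots j r hj hr (hK.reaches hjK (hinit.mem_of_reaches hrv hv))
    exact hrv
  refine ⟨fun v => hinit.reaches_inducedOn (hreach v v.2) _ _, fun u hu => hj u hu,
    fun v hv => ?_⟩
  rcases Relation.ReflTransGen.cases_tail (hreach v v.2) with h | ⟨w, _, hw⟩
  · exact absurd (Subtype.ext h) hv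
  · exact ⟨⟨w, hinit w v hw v.2⟩, hw, fun y hy => Subtype.ext (hF.unique _ _ _ hy hw)⟩

/-- Every vertex of K becomes an isolated source of arcs, entered by none. A root outside K reached
from K would be reachable from j in the original digraph. -/
theorem removeWithin_mem_maxOutForests (hK : G.IsBasisBicomponent K) (hF : F ∈ G.maxOutForests)
    (hj : F.IsRoot j) (hjK : j ∈ K) : F.removeWithin K ∈ (G.removeWithin K).maxOutForests := by
  obtain ⟨hFG, hF, hroots⟩ := mem_maxOutForests_iff.1 hF
  have hinit := hK.isInitial.mono hFG
  refine mem_maxOutForests_iff.2 ⟨removeWithin_mono hFG,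
    ⟨fun u u' v h h' => hF.unique _ _ _ h.1 h'.1, fun v => ?_⟩, fun r r' hr hr' h => ?_⟩
  · obtain ⟨r, hr, hrv⟩ := hF.exists_root v
    rcases reaches_removeWithin (K := K) hrv with h | ⟨k, hk, h⟩
    · exact ⟨r, hr.mono removeWithin_le, h⟩
    · exact ⟨k, hinit.isRoot_removeWithin hk, h⟩
  · by_cases hrK' : r' ∈ K
    · exact (hK.isInitial.isRoot_removeWithin hrK').eq_of_reaches h
    have hroot' := isRoot_of_isRoot_removeWithin hrK' hr'
    by_cases hrK : r ∈ K
    · have := hroots j r' hj hroot' ((hK.reaches hjK hrK).trans (h.mono removeWithin_le))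
      exact absurd (this ▸ hjK) hrK'
    · exact hroots r r' (isRoot_of_isRoot_removeWithin hrK hr) hroot' (h.mono removeWithin_le)

theorem joinOn_mem_maxOutForests (hK : G.IsBasisBicomponent K) {T : Digraph K} {j : K}
    (hTG : T ≤ G.inducedOn K) (hT : T.IsDivergingTree j)
    (hF : F ∈ (G.removeWithin K).maxOutForests) :
    joinOn T F ∈ G.maxOutForests ∧ (joinOn T F).IsRoot j := by
  obtain ⟨hFG, hF, hroots⟩ := mem_maxOutForests_iff.1 hF
  have hFK : ∀ u v, F.Adj u v → v ∉ K := fun u v h hv =>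
    hK.isInitial.isRoot_removeWithin hv u (hFG h)
  have hjroot : (joinOn T F).IsRoot j := by
    rintro u (⟨hu, _, h⟩ | h)
    · exact hT.root _ h
    · exact hFK _ _ h j.2
  have hFle : F ≤ joinOn T F := fun u v h => Or.inr h
  have hjreach : ∀ k (hk : k ∈ K), (joinOn T F).Reaches j k := fun k hk =>
    Relation.ReflTransGen.lift (p := (joinOn T F).Adj) Subtype.val
      (fun a b h => Or.inl ⟨a.2, b.2, h⟩) _ _ (hT.reaches ⟨k, hk⟩)
  have hKroot : ∀ v ∈ K, (joinOn T F).IsRoot v → v = j := fun v hv h =>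
    ((h.eq_of_reaches (hjreach v hv))).symm
  refine ⟨mem_maxOutForests_iff.2 ⟨?_, ⟨?_, fun v => ?_⟩, fun r r' hr hr' h => ?_⟩, hjroot⟩
  · rintro u v (⟨_, _, h⟩ | h)
    · exact hTG h
    · exact (hFG h).1
  · rintro u u' v (⟨hu, hv, h⟩ | h) (⟨hu', hv', h'⟩ | h')
    · have hne : (⟨v, hv⟩ : K) ≠ j := fun he => hT.root _ (he ▸ h)
      exact congrArg Subtype.val ((hT.existsUnique_arc _ hne).unique h h')
    · exact absurd hv (hFK _ _ h')
    · exact absurd hv' (hFK _ _ h)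
    · exact hF.unique _ _ _ h h'
  · obtain ⟨r, hr, hrv⟩ := hF.exists_root v
    by_cases hrK : r ∈ K
    · exact ⟨j, hjroot, (hjreach r hrK).trans (hrv.mono hFle)⟩
    · refine ⟨r, ?_, hrv.mono hFle⟩
      rintro u (⟨_, hr', _⟩ | h)
      · exact hrK hr'
      · exact hr u h
  · by_cases hrK' : r' ∈ K
    · rw [hKroot r' hrK' hr', hKroot r (hK.isInitial.mem_of_reaches h hrK') hr]
    · rcases reaches_removeWithin (K := K) h with h | ⟨k, hk, h⟩
      · exact hroots r r' (hr.mono hFle) (hr'.mono hFle) h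
      · have := hroots k r' ((hK.isInitial.isRoot_removeWithin hk).mono hFG) (hr'.mono hFle) h
        exact absurd (this ▸ hk) hrK'

/-- Suppose the root r above i is outside K. No vertex of K reaches r after the removal, since r
would then reach it back although no arc enters it. So r is a source of the full digraph, in another
basis bicomponent that reaches i. -/
theorem exists_reaches_of_mem_exclusiveReach (hK : G.IsBasisBicomponent K)
    (hi : i ∈ G.exclusiveReach K) (hF : F ∈ (G.removeWithin K).maxOutForests) :
    ∃ k ∈ K, F.Reaches k i := by
  obtain ⟨r, hr, hri⟩ := (isForest_of_mem_maxOutForests hF).exists_root i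
  have hFG := (mem_maxOutForests_iff.1 hF).1
  by_cases hrK : r ∈ K
  · exact ⟨r, hrK, hri⟩
  have hsource : G.IsSource r := by
    intro u hu
    rcases reaches_removeWithin (K := K) hu with h | ⟨k, hk, h⟩
    · exact (isSource_of_isRoot hF hr u h).mono removeWithin_le
    · have := (hK.isInitial.isRoot_removeWithin hk).eq_of_reaches (isSource_of_isRoot hF hr k h)
      exact absurd (this ▸ hk) hrK
  obtain ⟨K', hK', hrK'⟩ := mem_basisVertices_iff.2 hsource
  exact absurd ((hri.mono hFG).mono removeWithin_le)
    (hi.2 K' hK' (fun he => hrK (he ▸ hrK')) r hrK')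

end Finite

theorem IsDivergingTree.root_unique {T : Digraph V} {r r' : V} (h : T.IsDivergingTree r)
    (h' : T.IsDivergingTree r') : r = r' :=
  IsRoot.eq_of_reaches h'.root (h.reaches r')

end Digraph
-- Weights and the product formula
namespace WeightedDigraph

open Digraph

variable {V : Type*} {Γ : WeightedDigraph V} {K : Set V}

section Finite

variable [Finite V]

theorem prod_weight_pos {H : Digraph V} (h : H ≤ Γ.toDigraph) :
    0 < ∏ p ∈ H.arcs, Γ.weight p.1 p.2 :=
  Finset.prod_pos fun _ hp => Γ.weight_pos _ _ (h (mem_arcs.1 hp))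

theorem weightOf_nonneg {S : Set (Digraph V)} (hS : ∀ H ∈ S, H ≤ Γ.toDigraph) :
    0 ≤ Γ.weightOf S :=
  Finset.sum_nonneg fun H hH => (prod_weight_pos (hS H ((Set.Finite.mem_toFinset _).1 hH))).le

theorem weightOf_pos {S : Set (Digraph V)} (hS : ∀ H ∈ S, H ≤ Γ.toDigraph) (hne : S.Nonempty) :
    0 < Γ.weightOf S :=
  Finset.sum_pos (fun H hH => prod_weight_pos (hS H ((Set.Finite.mem_toFinset _).1 hH)))
    ((Set.Finite.toFinset_nonempty _).2 hne)

theorem weightOf_ne_zero_iff {S : Set (Digraph V)} (hS : ∀ H ∈ S, H ≤ Γ.toDigraph) :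
    Γ.weightOf S ≠ 0 ↔ S.Nonempty := by
  refine ⟨fun h => ?_, fun h => (weightOf_pos hS h).ne'⟩
  by_contra hne
  obtain rfl := Set.not_nonempty_iff_eq_empty.1 hne
  exact h (by simp [weightOf])

theorem sum_weightOf {ι : Type*} [Fintype ι] {S : Set (Digraph V)} {P : Digraph V → ι → Prop}
    (h : ∀ H ∈ S, ∃! k, P H k) : ∑ k, Γ.weightOf {H | H ∈ S ∧ P H k} = Γ.weightOf S := by
  classical
  have hfilter : ∀ k, Γ.weightOf {H | H ∈ S ∧ P H k} = ∑ H ∈ (Set.toFinite S).toFinset,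
      if P H k then ∏ p ∈ H.arcs, Γ.weight p.1 p.2 else 0 := by
    intro k
    rw [weightOf, ← Finset.sum_filter]
    congr 1
    ext H
    simp
  simp_rw [hfilter]
  rw [Finset.sum_comm, weightOf]
  refine Finset.sum_congr rfl fun H hH => ?_
  obtain ⟨k, hk, huniq⟩ := h H ((Set.Finite.mem_toFinset _).1 hH)
  rw [Finset.sum_eq_single k (fun b _ hb => if_neg fun hp => hb (huniq b hp))
    (fun hk => absurd (Finset.mem_univ k) hk), if_pos hk]

theorem prod_weight_split (w : V → V → ℝ) (F : Digraph V) (K : Set V) :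
    ∏ p ∈ F.arcs, w p.1 p.2 = (∏ p ∈ (F.inducedOn K).arcs, w p.1 p.2) *
      ∏ p ∈ (F.removeWithin K).arcs, w p.1 p.2 := by
  classical
  rw [← Finset.prod_filter_mul_prod_filter_not F.arcs (fun p => p.1 ∈ K ∧ p.2 ∈ K)]
  congr 1
  · symm
    refine Finset.prod_bij (fun p _ => (p.1.1, p.2.1)) ?_ ?_ ?_ fun _ _ => rfl
    · intro p hp
      have h : (F.inducedOn K).Adj p.1 p.2 := mem_arcs.1 hp
      exact Finset.mem_filter.2 ⟨mem_arcs.2 h, p.1.2, p.2.2⟩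
    · rintro ⟨a, b⟩ _ ⟨c, d⟩ _ h
      simpa [Subtype.ext_iff] using h
    · rintro ⟨u, v⟩ hp
      obtain ⟨h, hu, hv⟩ := Finset.mem_filter.1 hp
      have h' : (F.inducedOn K).Adj ⟨u, hu⟩ ⟨v, hv⟩ := mem_arcs.1 h
      exact ⟨(⟨u, hu⟩, ⟨v, hv⟩), mem_arcs.2 h', rfl⟩
  · congr 1
    ext p
    rw [Finset.mem_filter, mem_arcs, mem_arcs, removeWithin]

/-- Splitting and gluing are mutually inverse, and the arc weights factor accordingly.
`removeWithin` and `deleteWithin` have definitionally the same arcs. -/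
theorem weightOf_inTreeFrom (hK : Γ.toDigraph.IsBasisBicomponent K) (j : K) (i : V) :
    Γ.weightOf {F | F ∈ Γ.toDigraph.maxOutForests ∧ F.InTreeFrom i j} =
      Γ.treeWeightFrom K j * Γ.forestWeightTo K i := by
  classical
  rw [treeWeightFrom, forestWeightTo, weightOf, weightOf, weightOf, Finset.sum_mul_sum,
    ← Finset.sum_product']
  refine Finset.sum_bij' (fun F _ => (F.inducedOn K, F.removeWithin K))
    (fun p _ => joinOn p.1 p.2) ?_ ?_ ?_ ?_ ?_
  · intro F hF
    obtain ⟨hF, hij⟩ := (Set.Finite.mem_toFinset _).1 hF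
    refine Finset.mem_product.2 ⟨(Set.Finite.mem_toFinset _).2 ⟨fun u v h =>
      (mem_maxOutForests_iff.1 hF).1 h, isDivergingTree_inducedOn hK hF hij.isRoot j.2⟩,
      (Set.Finite.mem_toFinset _).2 ⟨removeWithin_mem_maxOutForests hK hF hij.isRoot j.2, ?_⟩⟩
    rcases reaches_removeWithin (K := K) hij.reaches with h | h
    · exact ⟨j, j.2, h⟩
    · exact h
  · rintro ⟨T, F⟩ hp
    obtain ⟨hT, hF⟩ := Finset.mem_product.1 hp
    obtain ⟨hTG, hT⟩ := (Set.Finite.mem_toFinset _).1 hT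
    obtain ⟨hF, k, hk, hki⟩ := (Set.Finite.mem_toFinset _).1 hF
    obtain ⟨hmem, hroot⟩ := joinOn_mem_maxOutForests hK hTG hT hF
    have hjk : (joinOn T F).Reaches j k :=
      Relation.ReflTransGen.lift (p := (joinOn T F).Adj) Subtype.val
        (fun a b h => Or.inl ⟨a.2, b.2, h⟩) _ _ (hT.reaches ⟨k, hk⟩)
    exact (Set.Finite.mem_toFinset _).2 ⟨hmem,
      (isForest_of_mem_maxOutForests hmem).inTreeFrom hroot
        (hjk.trans (hki.mono fun u v h => Or.inr h))⟩
  · intro F _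
    ext u v
    simp only [joinOn, inducedOn, removeWithin, exists_prop]
    tauto
  · rintro ⟨T, F⟩ hp
    obtain ⟨hT, hF⟩ := Finset.mem_product.1 hp
    have hFG := (mem_maxOutForests_iff.1 ((Set.Finite.mem_toFinset _).1 hF).1).1
    have hFK : ∀ u v, F.Adj u v → ¬ (u ∈ K ∧ v ∈ K) := fun u v h => (hFG h).2
    refine Prod.ext ?_ ?_
    · ext u v
      refine ⟨fun h => ?_, fun h => Or.inl ⟨u.2, v.2, h⟩⟩
      rcases h with ⟨_, _, h⟩ | h
      · exact h
      · exact absurd ⟨u.2, v.2⟩ (hFK _ _ h)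
    · ext u v
      refine ⟨?_, fun h => ⟨Or.inr h, hFK u v h⟩⟩
      rintro ⟨⟨hu, hv, _⟩ | h, hn⟩
      · exact absurd ⟨hu, hv⟩ hn
      · exact h
  · intro F _
    exact prod_weight_split Γ.weight F K

theorem forestWeightTo_of_mem_exclusiveReach (hK : Γ.toDigraph.IsBasisBicomponent K) {i : V}
    (hi : i ∈ Γ.toDigraph.exclusiveReach K) : Γ.forestWeightTo K i =
      (Γ.deleteWithin K).weightOf (Γ.deleteWithin K).toDigraph.maxOutForests := by
  rw [forestWeightTo]
  congr 1
  ext F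
  exact and_iff_left_of_imp fun hF => exists_reaches_of_mem_exclusiveReach hK hi hF

/-! ### Entries of the normalized matrix -/

theorem le_of_mem_maxOutForests {F : Digraph V} (hF : F ∈ Γ.toDigraph.maxOutForests) :
    F ≤ Γ.toDigraph :=
  hF.1.1

theorem sigmaMax_pos (Γ : WeightedDigraph V) : 0 < Γ.sigmaMax :=
  weightOf_pos (fun _ => le_of_mem_maxOutForests) Γ.toDigraph.maxOutForests_nonempty

theorem normalizedForestMatrix_nonneg (i j : V) : 0 ≤ Γ.normalizedForestMatrix i j :=
  div_nonneg (weightOf_nonneg fun _ h => le_of_mem_maxOutForests h.1) Γ.sigmaMax_pos.le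

theorem normalizedForestMatrix_ne_zero_iff {i j : V} : Γ.normalizedForestMatrix i j ≠ 0 ↔
    j ∈ Γ.toDigraph.basisVertices ∧ Γ.toDigraph.Reaches j i := by
  rw [normalizedForestMatrix, Matrix.of_apply, div_ne_zero_iff,
    and_iff_left Γ.sigmaMax_pos.ne', weightOf_ne_zero_iff fun _ h => le_of_mem_maxOutForests h.1,
    mem_basisVertices_iff]
  constructor
  · rintro ⟨F, hF, hij⟩
    exact ⟨isSource_of_isRoot hF hij.isRoot, hij.reaches.mono hF.1.1⟩
  · rintro ⟨hj, h⟩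
    obtain ⟨F, hF, hij⟩ := exists_maxOutForest_reaches hj h
    exact ⟨F, hF, hij⟩

theorem normalizedForestMatrix_eq (hK : Γ.toDigraph.IsBasisBicomponent K) (j : K) (i : V) :
    Γ.normalizedForestMatrix i j =
      Γ.treeWeightFrom K j * Γ.forestWeightTo K i / Γ.sigmaMax := by
  rw [normalizedForestMatrix, Matrix.of_apply, weightOf_inTreeFrom hK]

theorem normalizedForestMatrix_eq_diag (hK : Γ.toDigraph.IsBasisBicomponent K) (j : K) {i : V}
    (hi : i ∈ Γ.toDigraph.exclusiveReach K) :
    Γ.normalizedForestMatrix i j = Γ.normalizedForestMatrix j j := by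
  rw [normalizedForestMatrix_eq hK, normalizedForestMatrix_eq hK,
    forestWeightTo_of_mem_exclusiveReach hK hi,
    forestWeightTo_of_mem_exclusiveReach hK (hK.subset_exclusiveReach j.2)]

/-- A zero factor would make the diagonal entry vanish, although j is in a basis bicomponent and
reaches itself. -/
theorem treeWeightFrom_ne_zero (hK : Γ.toDigraph.IsBasisBicomponent K) (j : K) :
    Γ.treeWeightFrom K j ≠ 0 := by
  intro h
  refine normalizedForestMatrix_ne_zero_iff.2 ⟨⟨K, hK, j.2⟩, .refl⟩
    (?_ : Γ.normalizedForestMatrix j j = 0)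
  rw [normalizedForestMatrix_eq hK, h, zero_mul, zero_div]

theorem sum_treeWeightFrom [Fintype K] : ∑ j, Γ.treeWeightFrom K j = Γ.treeWeight K := by
  rw [treeWeight, ← sum_weightOf (P := fun T j => T.IsDivergingTree j)]
  · refine Finset.sum_congr rfl fun j _ => ?_
    rw [treeWeightFrom]
    congr 1
    ext T
    exact ⟨fun h => ⟨⟨j, h⟩, h.2⟩, fun ⟨⟨_, h⟩, hj⟩ => ⟨h.1, hj⟩⟩
  · rintro T ⟨r, -, hr⟩
    exact ⟨r, hr, fun _ h => h.root_unique hr⟩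

end Finite

variable [Fintype V]

theorem sum_normalizedForestMatrix (i : V) : ∑ k, Γ.normalizedForestMatrix i k = 1 := by
  simp only [normalizedForestMatrix, Matrix.of_apply]
  rw [← Finset.sum_div, sum_weightOf (P := fun F k => F.InTreeFrom i k) fun F hF =>
    (isForest_of_mem_maxOutForests hF).existsUnique_inTreeFrom i]
  exact div_self Γ.sigmaMax_pos.ne'

/-- The diagonal entries over K are the entries of the row of any i in K, and that row vanishes off
K because only vertices of K reach i. -/
theorem sum_diag_normalizedForestMatrix [Fintype K] (hK : Γ.toDigraph.IsBasisBicomponent K) :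
    ∑ j : K, Γ.normalizedForestMatrix j j = 1 := by
  classical
  obtain ⟨i, hi⟩ := hK.1.prop.1
  rw [← sum_normalizedForestMatrix (Γ := Γ) i]
  calc ∑ j : K, Γ.normalizedForestMatrix j j = ∑ j : K, Γ.normalizedForestMatrix i j :=
        Finset.sum_congr rfl fun j _ =>
          (normalizedForestMatrix_eq_diag hK j (hK.subset_exclusiveReach hi)).symm
    _ = ∑ j ∈ K.toFinset, Γ.normalizedForestMatrix i j :=
        (Finset.sum_subtype _ (fun _ => Set.mem_toFinset) _).symm
    _ = ∑ j, Γ.normalizedForestMatrix i j := by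
        refine Finset.sum_subset (Finset.subset_univ _) fun j _ hj => ?_
        by_contra hne
        exact hj (Set.mem_toFinset.2
          (hK.isInitial.mem_of_reaches (normalizedForestMatrix_ne_zero_iff.1 hne).2 hi))

theorem normalizedForestMatrix_diag (hK : Γ.toDigraph.IsBasisBicomponent K) (j : K) :
    Γ.normalizedForestMatrix j j = Γ.treeWeightFrom K j / Γ.treeWeight K := by
  classical
  have hdiag : ∀ k : K, Γ.normalizedForestMatrix k k = Γ.treeWeightFrom K k *
      ((Γ.deleteWithin K).weightOf (Γ.deleteWithin K).toDigraph.maxOutForests / Γ.sigmaMax) := by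
    intro k
    rw [normalizedForestMatrix_eq hK, mul_div_assoc,
      forestWeightTo_of_mem_exclusiveReach hK (hK.subset_exclusiveReach k.2)]
  have : Fintype K := Fintype.ofFinite K
  have hsum := sum_diag_normalizedForestMatrix hK
  simp_rw [hdiag] at hsum
  rw [← Finset.sum_mul, sum_treeWeightFrom] at hsum
  -- The diagonal entries share one factor; their sum being 1 makes it the inverse of the total tree
  -- weight.
  rw [hdiag, eq_inv_of_mul_eq_one_right hsum, div_eq_mul_inv]

theorem finsum_diag_normalizedForestMatrix (hK : Γ.toDigraph.IsBasisBicomponent K) :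
    ∑ᶠ j ∈ K, Γ.normalizedForestMatrix j j = 1 := by
  have : Fintype K := Fintype.ofFinite K
  rw [← finsum_set_coe_eq_finsum_mem, finsum_eq_sum_of_fintype]
  exact sum_diag_normalizedForestMatrix hK

end WeightedDigraph

open WeightedDigraph

theorem theorem2 {V : Type*} [Fintype V] (Γ : WeightedDigraph V) :
    -- row stochasticity
    ((∀ i j, 0 ≤ Γ.normalizedForestMatrix i j) ∧
      ∀ i, ∑ k, Γ.normalizedForestMatrix i k = 1) ∧
    -- the nonzero entries
    (∀ i j, Γ.normalizedForestMatrix i j ≠ 0 ↔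
      j ∈ Γ.toDigraph.basisVertices ∧ Γ.toDigraph.Reaches j i) ∧
    -- the entries in the columns of a basis bicomponent
    (∀ K, Γ.toDigraph.IsBasisBicomponent K → ∀ j : K,
      (∀ i, Γ.normalizedForestMatrix i j =
        Γ.treeWeightFrom K j * Γ.forestWeightTo K i / Γ.sigmaMax) ∧
      ∀ i ∈ Γ.toDigraph.exclusiveReach K,
        Γ.normalizedForestMatrix i j = Γ.normalizedForestMatrix j j ∧
        Γ.normalizedForestMatrix j j = Γ.treeWeightFrom K j / Γ.treeWeight K) ∧
    -- the diagonal entries over a basis bicomponent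
    ((∀ K, Γ.toDigraph.IsBasisBicomponent K → ∑ᶠ j ∈ K, Γ.normalizedForestMatrix j j = 1) ∧
      ∀ j, Γ.toDigraph.IsUndominated j → Γ.normalizedForestMatrix j j = 1) ∧
    -- proportionality of the columns of a basis bicomponent
    (∀ K, Γ.toDigraph.IsBasisBicomponent K → ∀ j₁ j₂ : K, ∀ i,
      Γ.normalizedForestMatrix i j₂ =
        Γ.treeWeightFrom K j₂ / Γ.treeWeightFrom K j₁ * Γ.normalizedForestMatrix i j₁) := by
  refine ⟨⟨fun i j => normalizedForestMatrix_nonneg i j, sum_normalizedForestMatrix⟩,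
    fun i j => normalizedForestMatrix_ne_zero_iff, fun K hK j => ⟨normalizedForestMatrix_eq hK j,
      fun i hi => ⟨normalizedForestMatrix_eq_diag hK j hi, normalizedForestMatrix_diag hK j⟩⟩,
    ⟨fun K hK => finsum_diag_normalizedForestMatrix hK, fun j hj => ?_⟩,
    fun K hK j₁ j₂ i => ?_⟩
  · simpa using finsum_diag_normalizedForestMatrix hj
  · rw [normalizedForestMatrix_eq hK, normalizedForestMatrix_eq hK]
    have := treeWeightFrom_ne_zero hK j₁
    field_simp
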